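/- Let $D\ge 2$ and let $T^{\mu\nu}$ be (the components in the canonical coordinates of) a smooth symmetric contravariant tensor field of degree 2 on $\mathbb R^D$ satisfying $\sum_{\mu=1}^{D}\partial_\mu T^{\mu\nu}=0$ for every $\nu$. Then there is a smooth contravariant tensor field $R^{\lambda\mu\rho\nu}$ of degree 4 on $\mathbb R^D$ with the symmetries of the Riemann curvature tensor, i.e. $$R^{\lambda\mu\rho\nu}=-R^{\mu\lambda\rho\nu}=-R^{\lambda\mu\nu\rho}=R^{\rho\nu\lambda\mu},\qquad R^{\lambda\mu\rho\nu}+R^{\mu\rho\lambda\nu}+R^{\rho\lambda\mu\nu}=0,$$ such that for all $\mu,\nu$ $$T^{\mu\nu}=\sum_{\lambda,\rho=1}^{D}\partial_\lambda\partial_\rho R^{\lambda\mu\rho\nu}.$$ -/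

import Mathlib

open scoped ContDiff

/-- The partial derivative `∂_μ f` of a real function on `ℝ^D` in the canonical coordinates. -/
noncomputable def partialDeriv {D : ℕ} (μ : Fin D) (f : (Fin D → ℝ) → ℝ) (x : Fin D → ℝ) : ℝ :=
  fderiv ℝ f x (Pi.single μ 1)

/-- A smooth contravariant tensor field of degree 2 on `ℝ^D`, given by its components `T^{μν}`
in the canonical coordinates, which is symmetric. -/
structure IsSymmTensorField {D : ℕ} (T : Fin D → Fin D → (Fin D → ℝ) → ℝ) : Prop where
  smooth : ∀ μ ν, ContDiff ℝ ∞ (T μ ν)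
  symm : ∀ μ ν x, T μ ν x = T ν μ x

/-- A smooth contravariant tensor field of degree 4 on `ℝ^D`, given by its components `R^{κμρν}`,
which has the symmetries of the Riemann curvature tensor, that is the Young symmetry of the square
diagram with the two columns `(κ, μ)` and `(ρ, ν)`. -/
structure IsRiemannTensorField {D : ℕ}
    (R : Fin D → Fin D → Fin D → Fin D → (Fin D → ℝ) → ℝ) : Prop where
  smooth : ∀ κ μ ρ ν, ContDiff ℝ ∞ (R κ μ ρ ν)
  antisymm_left : ∀ κ μ ρ ν x, R κ μ ρ ν x = - R μ κ ρ ν x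
  antisymm_right : ∀ κ μ ρ ν x, R κ μ ρ ν x = - R κ μ ν ρ x
  pair_symm : ∀ κ μ ρ ν x, R κ μ ρ ν x = R ρ ν κ μ x
  bianchi : ∀ κ μ ρ ν x, R κ μ ρ ν x + R μ ρ κ ν x + R ρ κ μ ν x = 0

open MeasureTheory intervalIntegral

/-! The tensor `R` is the Kulkarni–Nomizu product of `x ⊗ x` with a suitable field `U`. If `U` is
symmetric and divergence-free, the double divergence of this product is `(E + D - 1)(E + D) U`,
where `E = x · ∂` is the Euler operator (`sum_sum_partialDeriv_positionKulkarniNomizu`). It remains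
to solve `(E + D - 1)(E + D) U = T` among such fields. Averaging along rays with weight `t ^ n`
inverts `E + n + 1` (`fderiv_rayAverage_self_add`) and preserves smoothness, symmetry and vanishing
divergence, so two averages, with weights `t ^ (D - 2)` and then `t ^ (D - 1)`, give `U`. The
hypothesis `2 ≤ D` makes the first exponent a natural number. -/

/-- The averaging operator `f ↦ ∫₀¹ t ^ n f(t x) dt` along the rays from the origin. -/
noncomputable def rayAverage {E F : Type} [NormedAddCommGroup E] [NormedSpace ℝ E]
    [NormedAddCommGroup F] [NormedSpace ℝ F] (n : ℕ) (f : E → F) (x : E) : F :=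
  ∫ t in (0 : ℝ)..1, t ^ n • f (t • x)

section RayAverage

variable {E F : Type} [NormedAddCommGroup E] [NormedSpace ℝ E]
  [NormedAddCommGroup F] [NormedSpace ℝ F]

theorem continuous_rayAverage (n : ℕ) {f : E → F} (hf : Continuous f) :
    Continuous (rayAverage n f) := by
  unfold rayAverage
  exact intervalIntegral.continuous_parametric_intervalIntegral_of_continuous' (by fun_prop) 0 1

/-- Differentiation under the integral sign: the chain rule for `x ↦ f (t • x)` produces one more
factor `t`, which raises the weight. -/
theorem hasFDerivAt_rayAverage [ProperSpace E] (n : ℕ) {f : E → F}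
    (hf : ContDiff ℝ 1 f) (x : E) :
    HasFDerivAt (rayAverage n f) (rayAverage (n + 1) (fderiv ℝ f) x) x := by
  have hf' : Continuous (fderiv ℝ f) := hf.continuous_fderiv one_ne_zero
  have hfc : Continuous f := hf.continuous
  have hcont : Continuous fun p : ℝ × E => p.1 ^ (n + 1) • fderiv ℝ f (p.1 • p.2) := by fun_prop
  -- Compactness of `[0, 1] × closedBall x 1` gives a constant that dominates the differentiated
  -- integrand near `x`.
  obtain ⟨C, hC⟩ := (isCompact_Icc.prod (isCompact_closedBall x 1) :
    IsCompact (Set.Icc (0 : ℝ) 1 ×ˢ Metric.closedBall x 1)).exists_bound_of_continuousOn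
      hcont.continuousOn
  refine (intervalIntegral.hasFDerivAt_integral_of_dominated_of_fderiv_le (μ := volume)
    (F := fun x t => t ^ n • f (t • x))
    (F' := fun x t => t ^ (n + 1) • fderiv ℝ f (t • x)) (bound := fun _ => C)
    (s := Metric.ball x 1) (Metric.ball_mem_nhds x one_pos) ?_ ?_ ?_ ?_ ?_ ?_)
  · exact Filter.Eventually.of_forall fun y =>
      Continuous.aestronglyMeasurable (by fun_prop)
  · exact Continuous.intervalIntegrable (by fun_prop) _ _
  · exact Continuous.aestronglyMeasurable (by fun_prop)
  · refine Filter.Eventually.of_forall fun t ht y hy => hC (t, y) ⟨?_, Metric.ball_subset_closedBall hy⟩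
    rw [Set.uIoc_of_le zero_le_one] at ht
    exact ⟨ht.1.le, ht.2⟩
  · exact intervalIntegrable_const
  · refine Filter.Eventually.of_forall fun t _ y _ => ?_
    have h1 : HasFDerivAt f (fderiv ℝ f (t • y)) (t • y) :=
      (hf.differentiable one_ne_zero _).hasFDerivAt
    have h2 : HasFDerivAt (fun z : E => t • z) (t • ContinuousLinearMap.id ℝ E) y :=
      (hasFDerivAt_id y).const_smul t
    refine ((h1.comp y h2).const_smul (t ^ n)).congr_fderiv ?_
    ext v
    simp [pow_succ, mul_smul]

/-- The derivative of an average is an average of `fderiv ℝ f`, with another codomain and weight `n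
+ 1`; hence the induction lets `F` and `n` vary. -/
theorem contDiff_nat_rayAverage [ProperSpace E] (m : ℕ) :
    ∀ {F : Type} [NormedAddCommGroup F] [NormedSpace ℝ F] (n : ℕ) {f : E → F},
      ContDiff ℝ m f → ContDiff ℝ m (rayAverage n f) := by
  induction m with
  | zero =>
    intro F _ _ n f hf
    exact contDiff_zero.2 (continuous_rayAverage n (contDiff_zero.1 hf))
  | succ m ih =>
    intro F _ _ n f hf
    have h1 : ContDiff ℝ 1 f := hf.of_le (by norm_cast; omega)
    have hd := hasFDerivAt_rayAverage n h1
    push_cast at hf ⊢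
    rw [contDiff_succ_iff_fderiv] at hf ⊢
    refine ⟨fun x => (hd x).differentiableAt, by simp, ?_⟩
    rw [show fderiv ℝ (rayAverage n f) = rayAverage (n + 1) (fderiv ℝ f) from
      funext fun x => (hd x).fderiv]
    exact ih (n + 1) hf.2.2

theorem contDiff_rayAverage [ProperSpace E] (n : ℕ) {f : E → F}
    (hf : ContDiff ℝ ∞ f) : ContDiff ℝ ∞ (rayAverage n f) :=
  contDiff_infty.2 fun m => contDiff_nat_rayAverage m n (contDiff_infty.1 hf m)

theorem fderiv_rayAverage_apply [ProperSpace E] [CompleteSpace F] (n : ℕ) {f : E → F}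
    (hf : ContDiff ℝ 1 f) (x v : E) :
    fderiv ℝ (rayAverage n f) x v = rayAverage (n + 1) (fun y => fderiv ℝ f y v) x := by
  have hf' : Continuous (fderiv ℝ f) := hf.continuous_fderiv one_ne_zero
  rw [(hasFDerivAt_rayAverage n hf x).fderiv]
  unfold rayAverage
  rw [ContinuousLinearMap.intervalIntegral_apply
    (Continuous.intervalIntegrable (by fun_prop) _ _)]
  simp

/-- Averaging with weight `t ^ n` inverts the Euler operator shifted by `n + 1`. -/
theorem fderiv_rayAverage_self_add [ProperSpace E] [CompleteSpace F] (n : ℕ) {f : E → F}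
    (hf : ContDiff ℝ 1 f) (x : E) :
    fderiv ℝ (rayAverage n f) x x + ((n : ℝ) + 1) • rayAverage n f x = f x := by
  have hf' : Continuous (fderiv ℝ f) := hf.continuous_fderiv one_ne_zero
  have hfc : Continuous f := hf.continuous
  rw [fderiv_rayAverage_apply n hf]
  unfold rayAverage
  rw [← intervalIntegral.integral_smul, ← intervalIntegral.integral_add
    (Continuous.intervalIntegrable (by fun_prop) _ _)
    (Continuous.intervalIntegrable (by fun_prop) _ _)]
  -- The integrand is the `t`-derivative of `t ^ (n + 1) • f (t • x)`, which equals `f x` at `t = 1`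
  -- and vanishes at `t = 0`.
  have key : ∀ t ∈ Set.uIcc (0 : ℝ) 1, HasDerivAt (fun t : ℝ => t ^ (n + 1) • f (t • x))
      (t ^ (n + 1) • fderiv ℝ f (t • x) x + ((n : ℝ) + 1) • t ^ n • f (t • x)) t := by
    intro t _
    have h1 : HasFDerivAt f (fderiv ℝ f (t • x)) (t • x) :=
      (hf.differentiable one_ne_zero _).hasFDerivAt
    have h2 : HasDerivAt (fun t : ℝ => t • x) x t := by
      simpa using (hasDerivAt_id t).smul_const x
    refine ((hasDerivAt_pow (n + 1) t).smul (h1.comp_hasDerivAt t h2)).congr_deriv ?_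
    simp [mul_smul]
  rw [intervalIntegral.integral_eq_sub_of_hasDerivAt key
    (Continuous.intervalIntegrable (by fun_prop) _ _)]
  simp

end RayAverage

section PartialDeriv

variable {D : ℕ}

theorem contDiff_partialDeriv (μ : Fin D) {f : (Fin D → ℝ) → ℝ} (hf : ContDiff ℝ ∞ f) :
    ContDiff ℝ ∞ (partialDeriv μ f) := by
  unfold partialDeriv
  exact (hf.fderiv_right (m := ∞) (by simp)).clm_apply contDiff_const

theorem fderiv_apply_eq_sum_partialDeriv (f : (Fin D → ℝ) → ℝ) (x v : Fin D → ℝ) :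
    fderiv ℝ f x v = ∑ ρ, v ρ * partialDeriv ρ f x := by
  conv_lhs => rw [pi_eq_sum_univ' v]
  simp [partialDeriv]

theorem fderiv_coord_mul (i : Fin D) {f : (Fin D → ℝ) → ℝ} (hf : ContDiff ℝ ∞ f)
    (x v : Fin D → ℝ) :
    fderiv ℝ (fun y => y i * f y) x v = v i * f x + x i * fderiv ℝ f x v := by
  have h1 : HasFDerivAt (fun y : Fin D → ℝ => y i) (ContinuousLinearMap.proj (R := ℝ) i) x :=
    hasFDerivAt_apply i x
  have h2 := (hf.differentiable (by simp) x).hasFDerivAt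
  rw [show fderiv ℝ (fun y => y i * f y) x = _ from (h1.mul h2).fderiv]
  simp
  ring

theorem partialDeriv_sub (μ : Fin D) {f g : (Fin D → ℝ) → ℝ} (hf : ContDiff ℝ ∞ f)
    (hg : ContDiff ℝ ∞ g) (x : Fin D → ℝ) :
    partialDeriv μ (fun y => f y - g y) x = partialDeriv μ f x - partialDeriv μ g x := by
  unfold partialDeriv
  rw [fderiv_fun_sub (hf.differentiable (by simp) x) (hg.differentiable (by simp) x)]
  rfl

theorem partialDeriv_sum {ι : Type*} (s : Finset ι) (μ : Fin D) {f : ι → (Fin D → ℝ) → ℝ}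
    (hf : ∀ i, ContDiff ℝ ∞ (f i)) (x : Fin D → ℝ) :
    partialDeriv μ (fun y => ∑ i ∈ s, f i y) x = ∑ i ∈ s, partialDeriv μ (f i) x := by
  unfold partialDeriv
  rw [fderiv_fun_sum fun i _ => (hf i).differentiable (by simp) x]
  simp

theorem contDiff_coord_mul (i : Fin D) {f : (Fin D → ℝ) → ℝ} (hf : ContDiff ℝ ∞ f) :
    ContDiff ℝ ∞ fun y => y i * f y := by fun_prop

/-- The divergence of `x^ρ f` is `(D + E) f` with `E` the Euler operator. -/
theorem sum_partialDeriv_coord_mul_left {f : (Fin D → ℝ) → ℝ} (hf : ContDiff ℝ ∞ f)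
    (x : Fin D → ℝ) :
    ∑ ρ, partialDeriv ρ (fun y => y ρ * f y) x = D * f x + fderiv ℝ f x x := by
  rw [fderiv_apply_eq_sum_partialDeriv f x x]
  unfold partialDeriv
  simp [fderiv_coord_mul _ hf, Finset.sum_add_distrib]

theorem sum_partialDeriv_coord_mul {V : Fin D → (Fin D → ℝ) → ℝ}
    (hV : ∀ ρ, ContDiff ℝ ∞ (V ρ)) (i : Fin D) (x : Fin D → ℝ) :
    ∑ ρ, partialDeriv ρ (fun y => y i * V ρ y) x = V i x + x i * ∑ ρ, partialDeriv ρ (V ρ) x := by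
  unfold partialDeriv
  simp [fderiv_coord_mul _ (hV _), Finset.sum_add_distrib, Finset.mul_sum, Pi.single_apply]

end PartialDeriv

section RayAverageTensor

variable {D : ℕ} {T : Fin D → Fin D → (Fin D → ℝ) → ℝ}

theorem IsSymmTensorField.rayAverage (hT : IsSymmTensorField T) (n : ℕ) :
    IsSymmTensorField fun μ ν => rayAverage n (T μ ν) where
  smooth μ ν := contDiff_rayAverage n (hT.smooth μ ν)
  symm μ ν x := by rw [show T μ ν = T ν μ from funext (hT.symm μ ν)]

/-- The divergence of the average is the average, with weight `t ^ (n + 1)`, of the divergence. -/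
theorem sum_partialDeriv_rayAverage {V : Fin D → (Fin D → ℝ) → ℝ}
    (hV : ∀ ρ, ContDiff ℝ ∞ (V ρ)) (hdiv : ∀ x, ∑ ρ, partialDeriv ρ (V ρ) x = 0)
    (n : ℕ) (x : Fin D → ℝ) :
    ∑ ρ, partialDeriv ρ (rayAverage n (V ρ)) x = 0 := by
  have hc : ∀ ρ, Continuous (partialDeriv ρ (V ρ)) :=
    fun ρ => (contDiff_partialDeriv ρ (hV ρ)).continuous
  have h : ∀ ρ, partialDeriv ρ (rayAverage n (V ρ)) x
      = ∫ t in (0 : ℝ)..1, t ^ (n + 1) • partialDeriv ρ (V ρ) (t • x) := fun ρ =>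
    fderiv_rayAverage_apply n ((hV ρ).of_le (by simp)) x _
  simp_rw [h]
  rw [← intervalIntegral.integral_finsetSum fun ρ _ =>
    Continuous.intervalIntegrable (by have := hc ρ; fun_prop) _ _]
  simp [← Finset.mul_sum, hdiv]

end RayAverageTensor

/-- The Kulkarni–Nomizu product of `x ⊗ x` with a tensor field `U` of degree 2. -/
def positionKulkarniNomizu {D : ℕ} (U : Fin D → Fin D → (Fin D → ℝ) → ℝ)
    (κ μ ρ ν : Fin D) (x : Fin D → ℝ) : ℝ :=
  (x ρ * (x κ * U μ ν x) - x ρ * (x μ * U κ ν x)) -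
    (x κ * (x ν * U μ ρ x) - x μ * (x ν * U κ ρ x))

section KulkarniNomizu

variable {D : ℕ} {U : Fin D → Fin D → (Fin D → ℝ) → ℝ}

theorem IsSymmTensorField.isRiemannTensorField_positionKulkarniNomizu (hU : IsSymmTensorField U) :
    IsRiemannTensorField (positionKulkarniNomizu U) where
  smooth κ μ ρ ν := by
    have h := hU.smooth
    unfold positionKulkarniNomizu
    fun_prop
  antisymm_left κ μ ρ ν x := by unfold positionKulkarniNomizu; ring
  antisymm_right κ μ ρ ν x := by unfold positionKulkarniNomizu; ring
  pair_symm κ μ ρ ν x := by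
    unfold positionKulkarniNomizu
    rw [hU.symm μ ν, hU.symm κ ν, hU.symm μ ρ, hU.symm κ ρ]; ring
  bianchi κ μ ρ ν x := by
    unfold positionKulkarniNomizu
    rw [hU.symm ρ κ, hU.symm μ κ, hU.symm ρ μ]; ring

/-- Only the terms with factor `x ρ` feel the Euler operator. The terms in which a derivative hits
another coordinate cancel, by the symmetry of `U`; those containing the divergence of `U` vanish. -/
theorem sum_partialDeriv_positionKulkarniNomizu (hU : IsSymmTensorField U)
    (hdiv : ∀ ν x, ∑ μ, partialDeriv μ (U μ ν) x = 0) (κ μ ν : Fin D) (x : Fin D → ℝ) :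
    ∑ ρ, partialDeriv ρ (positionKulkarniNomizu U κ μ ρ ν) x =
      x κ * (D * U μ ν x + fderiv ℝ (U μ ν) x x) -
        x μ * (D * U κ ν x + fderiv ℝ (U κ ν) x x) := by
  have hs := hU.smooth
  have hc := fun i μ ν => contDiff_coord_mul i (hs μ ν)
  have hcc := fun j i μ ν => contDiff_coord_mul j (hc i μ ν)
  have hdiv' : ∀ μ, ∑ ρ, partialDeriv ρ (U μ ρ) x = 0 := fun μ => by
    simpa only [show ∀ ρ, U μ ρ = U ρ μ from fun ρ => funext (hU.symm μ ρ)] using hdiv μ x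
  have hsplit : ∀ ρ, partialDeriv ρ (positionKulkarniNomizu U κ μ ρ ν) x = _ := fun ρ =>
    partialDeriv_sub ρ ((hcc ρ κ μ ν).sub (hcc ρ μ κ ν)) ((hcc κ ν μ ρ).sub (hcc μ ν κ ρ)) x
  simp_rw [hsplit, partialDeriv_sub _ (hcc _ κ μ ν) (hcc _ μ κ ν),
    partialDeriv_sub _ (hcc κ ν μ _) (hcc μ ν κ _), Finset.sum_sub_distrib]
  rw [sum_partialDeriv_coord_mul_left (hc κ μ ν), sum_partialDeriv_coord_mul_left (hc μ κ ν),
    sum_partialDeriv_coord_mul (hc ν μ), sum_partialDeriv_coord_mul (hc ν κ),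
    sum_partialDeriv_coord_mul (hs μ), sum_partialDeriv_coord_mul (hs κ),
    fderiv_coord_mul _ (hs μ ν), fderiv_coord_mul _ (hs κ ν), hdiv', hdiv', hU.symm κ μ]
  ring

/-- With `S = (E + D) U`, the first divergence is `x κ * S μ ν - x μ * S κ ν`. In the second, the
derivative of `x μ` contributes `-S μ ν`, which turns `D` into `D - 1`. -/
theorem sum_sum_partialDeriv_positionKulkarniNomizu (hU : IsSymmTensorField U)
    (hdiv : ∀ ν x, ∑ μ, partialDeriv μ (U μ ν) x = 0)
    {S : Fin D → Fin D → (Fin D → ℝ) → ℝ} (hS : IsSymmTensorField S)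
    (hSdiv : ∀ ν x, ∑ μ, partialDeriv μ (S μ ν) x = 0)
    (hUS : ∀ μ ν x, fderiv ℝ (U μ ν) x x + D * U μ ν x = S μ ν x)
    (μ ν : Fin D) (x : Fin D → ℝ) :
    ∑ κ, ∑ ρ, partialDeriv κ (partialDeriv ρ (positionKulkarniNomizu U κ μ ρ ν)) x =
      fderiv ℝ (S μ ν) x x + (D - 1) * S μ ν x := by
  have hR := hU.isRiemannTensorField_positionKulkarniNomizu.smooth
  have h : ∀ κ, (fun y => ∑ ρ, partialDeriv ρ (positionKulkarniNomizu U κ μ ρ ν) y) =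
      fun y => y κ * S μ ν y - y μ * S κ ν y := fun κ => funext fun y => by
    rw [sum_partialDeriv_positionKulkarniNomizu hU hdiv, ← hUS μ ν, ← hUS κ ν]; ring
  simp_rw [← fun κ => partialDeriv_sum Finset.univ κ
    (fun ρ => contDiff_partialDeriv ρ (hR κ μ ρ ν)) x, h,
    fun κ => partialDeriv_sub κ (contDiff_coord_mul κ (hS.smooth μ ν))
      (contDiff_coord_mul μ (hS.smooth κ ν)) x, Finset.sum_sub_distrib]
  rw [sum_partialDeriv_coord_mul_left (hS.smooth μ ν),
    sum_partialDeriv_coord_mul (fun κ => hS.smooth κ ν), hSdiv]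
  ring

end KulkarniNomizu

theorem mainTheorem3 (D : ℕ) (hD : 2 ≤ D)
    (T : Fin D → Fin D → (Fin D → ℝ) → ℝ) (hT : IsSymmTensorField T)
    (hdiv : ∀ (ν : Fin D) (x : Fin D → ℝ), ∑ μ, partialDeriv μ (T μ ν) x = 0) :
    ∃ R : Fin D → Fin D → Fin D → Fin D → (Fin D → ℝ) → ℝ,
      IsRiemannTensorField R ∧
      ∀ (μ ν : Fin D) (x : Fin D → ℝ),
        T μ ν x = ∑ κ, ∑ ρ, partialDeriv κ (partialDeriv ρ (R κ μ ρ ν)) x := by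
  -- From here `D = n + 2`: weight `n` inverts `E + D - 1` and weight `n + 1` inverts `E + D`.
  obtain ⟨n, rfl⟩ := Nat.exists_eq_add_of_le' hD
  have hS := hT.rayAverage n
  have hSdiv := fun ν => sum_partialDeriv_rayAverage (fun μ => hT.smooth μ ν) (hdiv ν) n
  have hU := hS.rayAverage (n + 1)
  have hUdiv := fun ν => sum_partialDeriv_rayAverage (fun μ => hS.smooth μ ν) (hSdiv ν) (n + 1)
  refine ⟨_, hU.isRiemannTensorField_positionKulkarniNomizu, fun μ ν x => ?_⟩
  rw [sum_sum_partialDeriv_positionKulkarniNomizu hU hUdiv hS hSdiv]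
  · rw [← fderiv_rayAverage_self_add n ((hT.smooth μ ν).of_le (by simp)) x, smul_eq_mul]
    push_cast
    ring
  · intro μ ν x
    rw [← fderiv_rayAverage_self_add (n + 1) ((hS.smooth μ ν).of_le (by simp)) x, smul_eq_mul]
    push_cast
    ring
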